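/- Let $0<R<R_0\le R_1$, let $B(0,r)\subset\mathbb{R}^2$ be the open ball, let $I\subset\mathbb{R}$ be compact, and let $V:B(0,R_1)\to\mathbb{R}$ be bounded and measurable, extended by $0$ to a function $V_{per}$ on $\mathbb{R}^2$. Let $\varphi\in C_0^\infty(\mathbb{R}^2,\mathbb{R})$ be supported in $B(0,1)$ with $\int\varphi=1$, and put, for $\theta\in(0,1]$, $$\tilde V_\theta(x)=\int_{\mathbb{R}^2}\frac1{\theta^2}V_{per}(x-t)\,\varphi\!\left(\frac t\theta\right)dt,\qquad \operatorname{osc}(\theta)=\sup_{x_0\in B(0,R_0)}\ \sup_{t\in B(0,\theta)}|V_{per}(x_0-t)-V_{per}(x_0)| .$$ Let $\omega_V(\theta)=\operatorname{osc}(\theta)$ if $V_{per}$ is not constant on $B(0,R_0)$, and $\omega_V(\theta)=\max(\theta,\operatorname{osc}(\theta))$ if $V_{per}$ is constant on $B(0,R_0)$. (1) There are a positive function $\phi\in C^\infty(\mathbb{R}^2,\mathbb{R})$ and constants $h_0>0$, $\theta_0\in(0,1]$, $C>0$ such that, for all $E\in I$, $h\in(0,h_0]$, $\theta\in(0,\theta_0]$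 and all $u\in C^\infty(\mathbb{R}^2,\mathbb{C})$ with compact support contained in $B(0,R_0)$, $$h\int_{B(0,R_0)} e^{2\phi(x)\frac{\omega_V(\theta)^{1/2}}{h\theta^{1/2}}}\left(|u(x)|^2+\frac{\theta}{\omega_V(\theta)}|h\nabla u(x)|^2\right)dx\le C\,\frac{\theta^{3/2}}{\omega_V(\theta)^{3/2}}\int_{B(0,R_0)} e^{2\phi(x)\frac{\omega_V(\theta)^{1/2}}{h\theta^{1/2}}}\left|(-h^2\Delta+\tilde V_\theta(x)-E)u(x)\right|^2dx .$$ (2) There are a positive function $\phi\in C^\infty(\mathbb{R}^2,\mathbb{R})$ that is a strictly decreasing function of $|x|$ and constants $h_0>0$, $\theta_0\in(0,1]$, $C>0$ such that the same inequality holds for all $E\in I$, $h\in(0,h_0]$, $\theta\in(0,\theta_0]$ and all $u\in C^\infty(\mathbb{R}^2,\mathbb{C})$ with compact support contained in $B(0,R_0)\setminus B(0,R/2)$. -/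

import Mathlib

open scoped ContDiff Laplacian
open MeasureTheory

noncomputable section

/-- The Euclidean plane. -/
abbrev Plane : Type := EuclideanSpace ℝ (Fin 2)

/-- A regularizing kernel: smooth, real-valued, compactly supported in the open unit ball,
of total mass one (its sign is not prescribed). -/
structure IsRegularizingKernel (ρ : Plane → ℝ) : Prop where
  contDiff : ContDiff ℝ ∞ ρ
  hasCompactSupport : HasCompactSupport ρ
  tsupport_subset : tsupport ρ ⊆ Metric.ball 0 1
  integral_eq_one : ∫ x, ρ x = 1

/-- The extension of `V` by zero outside the ball `B(0, R₁)`. -/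
def zeroExtension (R₁ : ℝ) (V : Plane → ℝ) : Plane → ℝ :=
  (Metric.ball (0 : Plane) R₁).indicator V

/-- The regularized potential `x ↦ ∫ θ⁻² V(x - t) ρ(t / θ) dt`. -/
def regularized (ρ V : Plane → ℝ) (θ : ℝ) (x : Plane) : ℝ :=
  ∫ t : Plane, 1 / θ ^ 2 * V (x - t) * ρ (θ⁻¹ • t)

/-- The local oscillation `sup_{x₀ ∈ B(0, R₀)} sup_{t ∈ B(0, θ)} |V(x₀ - t) - V(x₀)|`. -/
def localOscillation (R₀ : ℝ) (V : Plane → ℝ) (θ : ℝ) : ℝ :=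
  ⨆ x₀ : Metric.ball (0 : Plane) R₀, ⨆ t : Metric.ball (0 : Plane) θ,
    |V (x₀.1 - t.1) - V x₀.1|

open Classical in
/-- The modulus `ω_V(θ)`. It is the local oscillation of `V`, except when `V` is constant on
`B(0, R₀)`, where the oscillation may vanish or be negligible against `θ`: there the
normalization `ω_V(θ) = θ` serves as a lower bound. -/
def omegaV (R₀ : ℝ) (V : Plane → ℝ) (θ : ℝ) : ℝ :=
  if ∃ c : ℝ, ∀ x ∈ Metric.ball (0 : Plane) R₀, V x = c then max θ (localOscillation R₀ V θ)
  else localOscillation R₀ V θ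

/-- `|∇u(x)|² = |∂₁u(x)|² + |∂₂u(x)|²`. -/
def gradNormSq (u : Plane → ℂ) (x : Plane) : ℝ :=
  ∑ i : Fin 2, ‖fderiv ℝ u x (EuclideanSpace.single i (1 : ℝ))‖ ^ 2

/-- The semiclassical Schrödinger operator `(-h²Δ + W - E) u`. -/
def schrodinger (h : ℝ) (W : Plane → ℝ) (E : ℝ) (u : Plane → ℂ) (x : Plane) : ℂ :=
  -((h : ℂ) ^ 2 * (Δ u) x) + ((W x - E : ℝ) : ℂ) * u x

/-- The weight `exp(2 φ(x) w^{1/2} / (h θ^{1/2}))`. -/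
def carlemanWeight (φ : Plane → ℝ) (w h θ : ℝ) (x : Plane) : ℝ :=
  Real.exp (2 * φ x * (w ^ (1 / 2 : ℝ) / (h * θ ^ (1 / 2 : ℝ))))

/-- The weighted Carleman inequality on `B(0, R₀)` for the potential `W`, the energy `E`, the
weight function `φ`, the modulus value `w`, the constant `C` and the function `u`. -/
def CarlemanInequality (R₀ : ℝ) (W : Plane → ℝ) (E : ℝ) (φ : Plane → ℝ) (w C h θ : ℝ)
    (u : Plane → ℂ) : Prop :=
  h * ∫ x in Metric.ball (0 : Plane) R₀,
      carlemanWeight φ w h θ x * (‖u x‖ ^ 2 + θ / w * (h ^ 2 * gradNormSq u x))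
    ≤ C * (θ ^ (3 / 2 : ℝ) / w ^ (3 / 2 : ℝ)) *
      ∫ x in Metric.ball (0 : Plane) R₀,
        carlemanWeight φ w h θ x * ‖schrodinger h W E u x‖ ^ 2

/-- Smooth complex-valued functions on the plane whose support is a compact subset of `S`. -/
def IsTestFunction (S : Set Plane) (u : Plane → ℂ) : Prop :=
  ContDiff ℝ ∞ u ∧ HasCompactSupport u ∧ tsupport u ⊆ S

/-- `φ` is a strictly decreasing function of `|x|`. -/
def RadiallyDecreasing (φ : Plane → ℝ) : Prop :=
  ∃ g : ℝ → ℝ, StrictAntiOn g (Set.Ici 0) ∧ ∀ x, φ x = g ‖x‖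

end

noncomputable section

/-! Put κ = (θ/ω)^{1/2} with ω = ω_V(θ). Multiplication by κ² turns the operator into -(hκ)²Δ + Q
with Q = κ²(Ṽ_θ - E), and the weight is exp(2φ/(hκ)). On B(0,R₀) the function Q is bounded in C¹
uniformly in θ and E: a derivative of Ṽ_θ costs only osc(θ)/θ ≤ ω/θ
(`abs_partialDeriv_regularized_le`), and κ² is bounded because ω ≥ cθ (`exists_mul_le_omegaV`). It
remains to prove a semiclassical Carleman estimate with parameter hκ for C¹-bounded potentials,
`carleman_real`; dividing it by κ leaves the factor κ³ of the theorem.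

The weight is a Gaussian g = A exp(-l|x-p|²). After conjugation by exp(g/h), the square of the
operator is a divergence plus squares plus a remainder (`sq_conj_eq_divergence_add`). The remainder
is positive where l|x-p|² ≥ 5/2, once A is large and the semiclassical parameter small
(`carleman_remainder_lower_bound`). Only the pole p must be avoided: it is placed outside B(0,R₀)
for the first claim, and at the origin for the second, where the removed disc makes a radial weight
admissible. -/

/-- The `i`-th partial derivative of a real function on the plane. -/
def partialDeriv (i : Fin 2) (f : Plane → ℝ) (x : Plane) : ℝ :=
  fderiv ℝ f x (EuclideanSpace.single i (1 : ℝ))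

/-! ### Partial derivatives on the plane -/

section Calculus

variable {f g : Plane → ℝ} {i : Fin 2}

lemma partialDeriv_add (hf : Differentiable ℝ f) (hg : Differentiable ℝ g) :
    partialDeriv i (fun x => f x + g x) = fun x => partialDeriv i f x + partialDeriv i g x := by
  ext x
  simp [partialDeriv, fderiv_fun_add (hf x) (hg x)]

lemma partialDeriv_sub (hf : Differentiable ℝ f) (hg : Differentiable ℝ g) :
    partialDeriv i (fun x => f x - g x) = fun x => partialDeriv i f x - partialDeriv i g x := by
  ext x
  simp [partialDeriv, fderiv_fun_sub (hf x) (hg x)]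

lemma partialDeriv_mul (hf : Differentiable ℝ f) (hg : Differentiable ℝ g) :
    partialDeriv i (fun x => f x * g x) =
      fun x => partialDeriv i f x * g x + f x * partialDeriv i g x := by
  ext x
  simp [partialDeriv, fderiv_fun_mul (hf x) (hg x)]
  ring

lemma partialDeriv_pow (hf : Differentiable ℝ f) (n : ℕ) :
    partialDeriv i (fun x => f x ^ n) = fun x => n * f x ^ (n - 1) * partialDeriv i f x := by
  ext x
  simp [partialDeriv, fderiv_fun_pow n (hf x)]

lemma partialDeriv_neg : partialDeriv i (fun x => -f x) = fun x => -partialDeriv i f x := by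
  ext x
  simp [partialDeriv]

lemma partialDeriv_const (c : ℝ) : partialDeriv i (fun _ => c) = fun _ => 0 := by
  ext x
  simp [partialDeriv]

lemma partialDeriv_exp (hf : Differentiable ℝ f) :
    partialDeriv i (fun x => Real.exp (f x)) = fun x => Real.exp (f x) * partialDeriv i f x := by
  ext x
  simp [partialDeriv, fderiv_exp (hf x)]

lemma partialDeriv_coord (j : Fin 2) :
    partialDeriv i (fun x : Plane => x j) = fun _ => if j = i then 1 else 0 := by
  ext x
  have : HasFDerivAt (fun x : Plane => x j)
      (EuclideanSpace.proj j : Plane →L[ℝ] ℝ) x :=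
    (EuclideanSpace.proj j : Plane →L[ℝ] ℝ).hasFDerivAt
  simp [partialDeriv, this.fderiv]

lemma contDiff_partialDeriv (hf : ContDiff ℝ ∞ f) : ContDiff ℝ ∞ (partialDeriv i f) :=
  (hf.fderiv_right (m := ∞) (by simp)).clm_apply contDiff_const

lemma continuous_partialDeriv (hf : ContDiff ℝ 1 f) : Continuous (partialDeriv i f) :=
  (hf.continuous_fderiv (by simp)).clm_apply continuous_const

lemma partialDeriv_comm (hf : ContDiff ℝ ∞ f) (j : Fin 2) :
    partialDeriv i (partialDeriv j f) = partialDeriv j (partialDeriv i f) := by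
  ext x
  have hd : DifferentiableAt ℝ (fderiv ℝ f) x :=
    ((hf.fderiv_right (m := ∞) (by simp)).differentiable (by simp)) x
  have hs : IsSymmSndFDerivAt ℝ f x :=
    hf.contDiffAt.isSymmSndFDerivAt (by simpa using (WithTop.coe_le_coe.2 le_top : ((2 : ℕ∞) : WithTop ℕ∞) ≤ ∞))
  have key (k l : Fin 2) : partialDeriv k (partialDeriv l f) x =
      fderiv ℝ (fderiv ℝ f) x (EuclideanSpace.single k 1) (EuclideanSpace.single l 1) := by
    change fderiv ℝ (fun y => fderiv ℝ f y (EuclideanSpace.single l (1 : ℝ))) x _ = _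
    rw [fderiv_clm_apply hd (differentiableAt_const _)]
    simp
  rw [key, key, hs.eq]

lemma tsupport_partialDeriv_subset : tsupport (partialDeriv i f) ⊆ tsupport f := by
  refine closure_minimal (fun x hx => ?_) (isClosed_tsupport f)
  by_contra h
  apply hx
  have : fderiv ℝ f x = 0 := by
    by_contra h'
    exact h (support_fderiv_subset ℝ h')
  simp [partialDeriv, this]

lemma partialDeriv_eq_zero_of_notMem_tsupport {x : Plane} (hx : x ∉ tsupport f) :
    partialDeriv i f x = 0 :=
  image_eq_zero_of_notMem_tsupport fun h => hx (tsupport_partialDeriv_subset h)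

lemma hasCompactSupport_partialDeriv (hf : HasCompactSupport f) :
    HasCompactSupport (partialDeriv i f) :=
  hf.of_isClosed_subset (isClosed_tsupport _) tsupport_partialDeriv_subset

lemma integral_partialDeriv_eq_zero (hf : ContDiff ℝ 1 f) (hs : HasCompactSupport f) :
    ∫ x, partialDeriv i f x = 0 := by
  have hc : Continuous fun x => fderiv ℝ f x (EuclideanSpace.single i (1 : ℝ)) :=
    continuous_partialDeriv (i := i) hf
  have h := integral_mul_fderiv_eq_neg_fderiv_mul_of_integrable (μ := volume)
    (f := fun _ : Plane => (1 : ℝ)) (g := f) (v := EuclideanSpace.single i (1 : ℝ))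
    (by simp) (by simpa using hc.integrable_of_hasCompactSupport (hasCompactSupport_partialDeriv hs))
    (by simpa using hf.continuous.integrable_of_hasCompactSupport hs)
    (fun _ _ => differentiableAt_const _) (fun _ _ => hf.differentiable (by simp) _)
  simpa [partialDeriv] using h

end Calculus

/-! ### Gaussian weight, divergence identity and positivity of the remainder -/

/-- Squared distance to `p`, in coordinates. -/
def sqDist (p x : Plane) : ℝ := (x 0 - p 0) ^ 2 + (x 1 - p 1) ^ 2

/-- The Gaussian `A exp(-l |x - p|²)`. -/
def gaussianWeight (A l : ℝ) (p x : Plane) : ℝ := A * Real.exp (-(l * sqDist p x))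

lemma contDiff_sqDist (p : Plane) : ContDiff ℝ ∞ (sqDist p) := by
  unfold sqDist
  fun_prop

lemma contDiff_gaussianWeight (A l : ℝ) (p : Plane) : ContDiff ℝ ∞ (gaussianWeight A l p) := by
  have := contDiff_sqDist p
  unfold gaussianWeight
  fun_prop

lemma partialDeriv_sqDist (p : Plane) (i : Fin 2) :
    partialDeriv i (sqDist p) = fun x => 2 * (x i - p i) := by
  unfold sqDist
  simp (disch := fun_prop) only [partialDeriv_add, partialDeriv_pow, partialDeriv_sub,
    partialDeriv_const, partialDeriv_coord]
  ext x
  fin_cases i <;> simp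

lemma partialDeriv_gaussianWeight (A l : ℝ) (p : Plane) (i : Fin 2) :
    partialDeriv i (gaussianWeight A l p) =
      fun x => -(2 * l * (x i - p i) * gaussianWeight A l p x) := by
  have := (contDiff_sqDist p).differentiable (by simp)
  unfold gaussianWeight
  simp (disch := fun_prop) only [partialDeriv_mul, partialDeriv_neg, partialDeriv_exp,
    partialDeriv_const, partialDeriv_sqDist]
  ext x
  ring

/-- The flux of the divergence identity behind the Carleman estimate, for the weight `g` with
`∇ g = -2 l (x - p) g`. -/
def carlemanFlux (h l : ℝ) (p : Plane) (g Q v : Plane → ℝ) (i : Fin 2) (x : Plane) : ℝ :=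
  -(4 * h ^ 3 * l * (x i - p i) * g x *
      (partialDeriv 0 v x ^ 2 + partialDeriv 1 v x ^ 2))
    + 8 * h ^ 3 * l * g x * partialDeriv i v x *
      ((x 0 - p 0) * partialDeriv 0 v x + (x 1 - p 1) * partialDeriv 1 v x)
    - 8 * h ^ 3 * (l ^ 2 * sqDist p x - l) * g x * v x * partialDeriv i v x
    - 4 * h * l * (Q x - 4 * l ^ 2 * sqDist p x * g x ^ 2) * (x i - p i) * g x * v x ^ 2
    - 12 * h ^ 3 * l * g x * v x * partialDeriv i v x

/-- The symmetric part of the conjugated operator. -/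
def conjSymm (h l : ℝ) (p : Plane) (g Q v : Plane → ℝ) (x : Plane) : ℝ :=
  -(h ^ 2 * (partialDeriv 0 (partialDeriv 0 v) x + partialDeriv 1 (partialDeriv 1 v) x))
    + (Q x - 4 * l ^ 2 * sqDist p x * g x ^ 2) * v x

/-- The antisymmetric part of the conjugated operator. -/
def conjAnti (h l : ℝ) (p : Plane) (g v : Plane → ℝ) (x : Plane) : ℝ :=
  -(4 * h * l * g x * ((x 0 - p 0) * partialDeriv 0 v x + (x 1 - p 1) * partialDeriv 1 v x))
    + 4 * h * (l ^ 2 * sqDist p x - l) * g x * v x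

/-- With a and b the symmetric and antisymmetric parts, integrating 2ab by parts produces the
Hessian of g, whose negative part contributes -8h³lg|∇v|². Completing a² to (a - 6hlgv)² brings in
12hlgva, which modulo a divergence contributes +12h³lg|∇v|²; the net gradient coefficient is +4. -/
lemma sq_conj_eq_divergence_add (h l A : ℝ) (p : Plane) {Q v : Plane → ℝ}
    (hQ : ContDiff ℝ 1 Q) (hv : ContDiff ℝ ∞ v) (x : Plane) {g : Plane → ℝ}
    (hg : g = gaussianWeight A l p) :
    (conjSymm h l p g Q v x + conjAnti h l p g v x) ^ 2 =
      partialDeriv 0 (carlemanFlux h l p g Q v 0) x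
      + partialDeriv 1 (carlemanFlux h l p g Q v 1) x
      + ((conjSymm h l p g Q v x - 6 * h * l * g x * v x) ^ 2 + conjAnti h l p g v x ^ 2
        - 36 * h ^ 2 * l ^ 2 * g x ^ 2 * v x ^ 2
        + 16 * h ^ 3 * l ^ 2 * g x *
          ((x 0 - p 0) * partialDeriv 0 v x + (x 1 - p 1) * partialDeriv 1 v x) ^ 2
        + 4 * h ^ 3 * l * g x * (partialDeriv 0 v x ^ 2 + partialDeriv 1 v x ^ 2)
        + h ^ 3 * v x * g x *
          ((x 0 - p 0) * partialDeriv 0 v x + (x 1 - p 1) * partialDeriv 1 v x) *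
          (8 * l ^ 2 - 16 * l ^ 3 * sqDist p x)
        + h * g x * l * v x ^ 2 *
          (4 * l * sqDist p x * g x ^ 2 * (16 * l ^ 2 * sqDist p x - 20 * l) + 12 * Q x
            + 4 * ((x 0 - p 0) * partialDeriv 0 Q x + (x 1 - p 1) * partialDeriv 1 Q x))) := by
  have h1 := (contDiff_sqDist p).differentiable (by simp)
  have h2 := (contDiff_gaussianWeight A l p).differentiable (by simp)
  have h3 := hQ.differentiable (by simp)
  have h4 := hv.differentiable (by simp)
  have h5 := fun i => (contDiff_partialDeriv (i := i) hv).differentiable (by simp)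
  have h6 := partialDeriv_comm (i := 1) hv 0
  unfold carlemanFlux
  rw [hg]
  simp (disch := fun_prop) only [partialDeriv_mul, partialDeriv_neg, partialDeriv_add,
    partialDeriv_sub, partialDeriv_pow, partialDeriv_coord,
    partialDeriv_const, partialDeriv_sqDist, partialDeriv_gaussianWeight, h6]
  simp only [conjSymm, conjAnti, sqDist, if_true, Nat.cast_ofNat, Nat.reduceSub, pow_one,
    zero_mul, mul_zero, zero_add, add_zero, sub_zero, one_ne_zero, zero_ne_one, if_false, one_mul,
    mul_one]
  -- The derivatives of `v` and `Q` at `x` enter as independent variables, so the claim is a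
  -- polynomial identity.
  generalize gaussianWeight A l p x = g
  generalize x 0 - p 0 = y₀
  generalize x 1 - p 1 = y₁
  generalize partialDeriv 0 (partialDeriv 0 v) x = v₀₀
  generalize partialDeriv 1 (partialDeriv 1 v) x = v₁₁
  generalize partialDeriv 0 (partialDeriv 1 v) x = v₀₁
  generalize partialDeriv 0 v x = v₀
  generalize partialDeriv 1 v x = v₁
  generalize partialDeriv 0 Q x = Q₀
  generalize partialDeriv 1 Q x = Q₁
  generalize Q x = q
  generalize v x = w
  clear h1 h2 h3 h4 h5 h6 hQ hv hg
  ring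

/-- The dominant term is cubic in `g`, while the potential enters linearly: a large lower bound `m`
on `g` absorbs `Q` and `∇Q`. The leftover negative terms carry an additional power of `h` and are
absorbed by `hhs`. -/
lemma carleman_remainder_lower_bound {h l A K S a b g v z G s q d₀ d₁ y₀ y₁ m : ℝ}
    (hh : 0 < h) (hh1 : h ≤ 1) (hhs : h * (36 * l * A + 4 * l ^ 3 * S ^ 2) ≤ 1)
    (hl : 0 < l) (hm1 : 1 ≤ m) (hm : 2 + 12 * K + 8 * K * (1 + S) ≤ 200 * l * m ^ 2)
    (hgm : m ≤ g) (hgA : g ≤ A) (hls : 5 / 2 ≤ l * s) (hsS : s ≤ S) (hs : s = y₀ ^ 2 + y₁ ^ 2)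
    (hG : 0 ≤ G) (hq : |q| ≤ K) (hd₀ : |d₀| ≤ K) (hd₁ : |d₁| ≤ K) :
    h * l * (v ^ 2 + 4 * h ^ 2 * G) ≤
      (a - 6 * h * l * g * v) ^ 2 + b ^ 2 - 36 * h ^ 2 * l ^ 2 * g ^ 2 * v ^ 2
      + 16 * h ^ 3 * l ^ 2 * g * z ^ 2 + 4 * h ^ 3 * l * g * G
      + h ^ 3 * v * g * z * (8 * l ^ 2 - 16 * l ^ 3 * s)
      + h * g * l * v ^ 2 *
        (4 * l * s * g ^ 2 * (16 * l ^ 2 * s - 20 * l) + 12 * q + 4 * (y₀ * d₀ + y₁ * d₁)) := by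
  have hg : 1 ≤ g := hm1.trans hgm
  have hK : 0 ≤ K := (abs_nonneg q).trans hq
  have hs0 : 0 ≤ s := by rw [hs]; positivity
  have hS0 : 0 ≤ S := hs0.trans hsS
  have key (y d : ℝ) (hy : y ^ 2 ≤ S) (hd : |d| ≤ K) : -(K * (1 + S)) ≤ y * d := by
    have h1 : |y| ≤ 1 + S := by
      rw [abs_le]; constructor <;> nlinarith
    have h2 : |y * d| ≤ (1 + S) * K := by
      rw [abs_mul]; gcongr
    linarith [neg_abs_le (y * d)]
  have e0 := key y₀ d₀ (by nlinarith [sq_nonneg y₁]) hd₀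
  have e1 := key y₁ d₁ (by nlinarith [sq_nonneg y₀]) hd₁
  -- From ls ≥ 5/2 the last bracket is at least 40l - 20l, and 200 = 4 · (5/2) · 20.
  have e2 : 200 * l * m ^ 2 ≤ 4 * l * s * g ^ 2 * (16 * l ^ 2 * s - 20 * l) := by
    have t1 : 20 * l ≤ 16 * l ^ 2 * s - 20 * l := by nlinarith
    have t2 : m ^ 2 ≤ g ^ 2 := by gcongr
    calc 200 * l * m ^ 2 = 4 * (5 / 2) * m ^ 2 * (20 * l) := by ring
      _ ≤ 4 * (l * s) * g ^ 2 * (16 * l ^ 2 * s - 20 * l) := by gcongr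
      _ = _ := by ring
  have e3 : 2 ≤ 4 * l * s * g ^ 2 * (16 * l ^ 2 * s - 20 * l) + 12 * q
      + 4 * (y₀ * d₀ + y₁ * d₁) := by
    linarith [neg_abs_le q]
  have e4 : h * g * l * v ^ 2 * 2 ≤ h * g * l * v ^ 2 *
      (4 * l * s * g ^ 2 * (16 * l ^ 2 * s - 20 * l) + 12 * q + 4 * (y₀ * d₀ + y₁ * d₁)) := by
    gcongr
  -- The mixed term in v and z is absorbed by completing the square in z, at the price of an h³v²
  -- term.
  have e5 : 16 * h ^ 3 * l ^ 2 * g * z ^ 2 + h ^ 3 * v * g * z * (8 * l ^ 2 - 16 * l ^ 3 * s)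
      = 16 * h ^ 3 * l ^ 2 * g * (z + v * (1 / 4 - l * s / 2)) ^ 2
        - 16 * h ^ 3 * l ^ 2 * g * v ^ 2 * (1 / 4 - l * s / 2) ^ 2 := by ring
  have e6 : (1 / 4 - l * s / 2) ^ 2 ≤ l ^ 2 * S ^ 2 / 4 := by
    have : l * s ≤ l * S := by gcongr
    nlinarith
  have e7 : 16 * h ^ 3 * l ^ 2 * g * v ^ 2 * (1 / 4 - l * s / 2) ^ 2
      ≤ 16 * h ^ 3 * l ^ 2 * g * v ^ 2 * (l ^ 2 * S ^ 2 / 4) := by gcongr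
  have e8 : h * (36 * l * g) + h ^ 2 * (4 * l ^ 3 * S ^ 2) ≤ 1 := by
    have t1 : h ^ 2 ≤ h := by nlinarith
    have t2 : h * (36 * l * g) ≤ h * (36 * l * A) := by gcongr
    have t3 : h ^ 2 * (4 * l ^ 3 * S ^ 2) ≤ h * (4 * l ^ 3 * S ^ 2) := by gcongr
    linarith
  have e9 : h * g * l * v ^ 2 * (h * (36 * l * g) + h ^ 2 * (4 * l ^ 3 * S ^ 2))
      ≤ h * g * l * v ^ 2 * 1 := by gcongr
  have e10 : h * l * v ^ 2 * 1 ≤ h * l * v ^ 2 * g := by gcongr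
  have e11 : 4 * h ^ 3 * l * G * 1 ≤ 4 * h ^ 3 * l * G * g := by gcongr
  have e12 : 0 ≤ 16 * h ^ 3 * l ^ 2 * g * (z + v * (1 / 4 - l * s / 2)) ^ 2 := by positivity
  have e13 := sq_nonneg (a - 6 * h * l * g * v)
  have e14 := sq_nonneg b
  generalize (a - 6 * h * l * g * v) ^ 2 = X at *
  generalize b ^ 2 = Y at *
  linarith

/-! ### Conjugation by the exponential weight -/

/-- The function `u` conjugated by `exp (g / h)`. -/
def expConj (h : ℝ) (g u : Plane → ℝ) (x : Plane) : ℝ := Real.exp (g x / h) * u x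

/-- The real operator `-h² Δ + Q`. -/
def realSchrodinger (h : ℝ) (Q u : Plane → ℝ) (x : Plane) : ℝ :=
  -(h ^ 2 * (partialDeriv 0 (partialDeriv 0 u) x + partialDeriv 1 (partialDeriv 1 u) x))
    + Q x * u x

section Conjugation

variable {h l A : ℝ} {p : Plane} {Q u : Plane → ℝ}

lemma contDiff_expConj (hu : ContDiff ℝ ∞ u) :
    ContDiff ℝ ∞ (expConj h (gaussianWeight A l p) u) := by
  have := contDiff_gaussianWeight A l p
  unfold expConj
  fun_prop

lemma tsupport_expConj_subset (g : Plane → ℝ) : tsupport (expConj h g u) ⊆ tsupport u :=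
  tsupport_mul_subset_right

lemma partialDeriv_expConj (hu : Differentiable ℝ u) (i : Fin 2) :
    partialDeriv i (expConj h (gaussianWeight A l p) u) = fun x =>
      Real.exp (gaussianWeight A l p x / h) *
        (partialDeriv i u x - 2 * l * (x i - p i) * gaussianWeight A l p x / h * u x) := by
  have := (contDiff_gaussianWeight A l p).differentiable (by simp)
  unfold expConj
  simp (disch := fun_prop) only [div_eq_mul_inv, partialDeriv_mul, partialDeriv_exp,
    partialDeriv_const, partialDeriv_gaussianWeight]
  ext x
  ring

lemma partialDeriv_partialDeriv_expConj (hu : ContDiff ℝ ∞ u) (i : Fin 2) :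
    partialDeriv i (partialDeriv i (expConj h (gaussianWeight A l p) u)) = fun x =>
      Real.exp (gaussianWeight A l p x / h) *
        (partialDeriv i (partialDeriv i u) x
          - 4 * l * (x i - p i) * gaussianWeight A l p x / h * partialDeriv i u x
          + 4 * l ^ 2 * (x i - p i) ^ 2 * gaussianWeight A l p x ^ 2 / h ^ 2 * u x
          + (4 * l ^ 2 * (x i - p i) ^ 2 - 2 * l) * gaussianWeight A l p x / h * u x) := by
  have h1 := (contDiff_gaussianWeight A l p).differentiable (by simp)
  have h2 := hu.differentiable (by simp)
  have h3 := (contDiff_partialDeriv (i := i) hu).differentiable (by simp)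
  rw [partialDeriv_expConj h2]
  simp (disch := fun_prop) only [div_eq_mul_inv, partialDeriv_mul, partialDeriv_exp,
    partialDeriv_sub, partialDeriv_coord, partialDeriv_const, partialDeriv_gaussianWeight]
  ext x
  simp only [if_true]
  ring

lemma conjSymm_add_conjAnti_expConj (hh : h ≠ 0) (hu : ContDiff ℝ ∞ u) (x : Plane)
    {g : Plane → ℝ} (hg : g = gaussianWeight A l p) :
    conjSymm h l p g Q (expConj h g u) x + conjAnti h l p g (expConj h g u) x =
      Real.exp (g x / h) * realSchrodinger h Q u x := by
  have h2 := hu.differentiable (by simp)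
  subst hg
  simp only [conjSymm, conjAnti, realSchrodinger, partialDeriv_partialDeriv_expConj hu]
  simp only [partialDeriv_expConj h2, expConj, sqDist]
  field_simp
  ring

end Conjugation

/-! ### The Carleman estimate for real functions -/

/-- The parameters of the real Carleman estimate are admissible. -/
structure CarlemanParams (l A K S m h : ℝ) : Prop where
  h_pos : 0 < h
  h_le_one : h ≤ 1
  h_small : h * (36 * l * A + 4 * l ^ 3 * S ^ 2) ≤ 1
  l_pos : 0 < l
  S_nonneg : 0 ≤ S
  one_le_m : 1 ≤ m
  m_large : 2 + 12 * K + 8 * K * (1 + S) ≤ 200 * l * m ^ 2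
  A_eq : A = m * Real.exp (l * S)

section Estimate

variable {h l A K S m : ℝ} {p : Plane} {Q u : Plane → ℝ}

/-- The potential is controlled and the weight is non-degenerate at `x`. -/
def CarlemanPoint (l K S : ℝ) (p : Plane) (Q : Plane → ℝ) (x : Plane) : Prop :=
  5 / 2 ≤ l * sqDist p x ∧ sqDist p x ≤ S ∧ |Q x| ≤ K ∧ ∀ i, |partialDeriv i Q x| ≤ K

lemma sqDist_nonneg (p x : Plane) : 0 ≤ sqDist p x := by
  unfold sqDist; positivity

/-- Off the support of `v` every term vanishes, so non-degeneracy is needed only on it. On it, A = m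
exp(lS) gives m ≤ g ≤ A. -/
lemma carleman_pointwise_conj (hP : CarlemanParams l A K S m h) {v : Plane → ℝ}
    (hQ : ContDiff ℝ 1 Q) (hv : ContDiff ℝ ∞ v) {x : Plane} {g : Plane → ℝ}
    (hg : g = gaussianWeight A l p) (hx : x ∈ tsupport v → CarlemanPoint l K S p Q x) :
    h * l * (v x ^ 2 + 4 * h ^ 2 * (partialDeriv 0 v x ^ 2 + partialDeriv 1 v x ^ 2)) ≤
      (conjSymm h l p g Q v x + conjAnti h l p g v x) ^ 2
      - (partialDeriv 0 (carlemanFlux h l p g Q v 0) x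
        + partialDeriv 1 (carlemanFlux h l p g Q v 1) x) := by
  rw [sq_conj_eq_divergence_add h l A p hQ hv x hg, add_sub_cancel_left]
  by_cases hxv : x ∈ tsupport v
  · obtain ⟨h1, h2, h3, h4⟩ := hx hxv
    have hl := hP.l_pos
    have hm := hP.one_le_m
    have hs0 := sqDist_nonneg p x
    refine carleman_remainder_lower_bound hP.h_pos hP.h_le_one hP.h_small hl hm hP.m_large
      ?_ ?_ h1 h2 rfl (by positivity) h3 (h4 0) (h4 1)
    · rw [hg, gaussianWeight, hP.A_eq, mul_assoc, ← Real.exp_add]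
      refine le_mul_of_one_le_right (by linarith) (Real.one_le_exp ?_)
      nlinarith
    · have hA : 0 ≤ A := by rw [hP.A_eq]; positivity
      rw [hg, gaussianWeight]
      exact mul_le_of_le_one_right hA (Real.exp_le_one_iff.2 (by nlinarith))
  · have d0 : v x = 0 := image_eq_zero_of_notMem_tsupport hxv
    have d1 (i) : partialDeriv i v x = 0 := partialDeriv_eq_zero_of_notMem_tsupport hxv
    have d2 (i) : partialDeriv i (partialDeriv i v) x = 0 :=
      partialDeriv_eq_zero_of_notMem_tsupport fun hh => hxv (tsupport_partialDeriv_subset hh)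
    simp [conjSymm, conjAnti, d0, d1, d2]

/-- Undoing the conjugation gives e^{g/h} h∂ᵢu = h∂ᵢv + 2l(xᵢ - pᵢ)gv. The inequality (α + β)² ≤ 2α²
+ 2β² then produces the factor 1 + 8l²SA². -/
lemma carleman_pointwise (hP : CarlemanParams l A K S m h)
    (hQ : ContDiff ℝ 1 Q) (hu : ContDiff ℝ ∞ u) {x : Plane} {g : Plane → ℝ}
    (hg : g = gaussianWeight A l p) (hx : x ∈ tsupport u → CarlemanPoint l K S p Q x) :
    h * l * (Real.exp (2 * g x / h) *
        (u x ^ 2 + h ^ 2 * (partialDeriv 0 u x ^ 2 + partialDeriv 1 u x ^ 2))) ≤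
      (1 + 8 * l ^ 2 * S * A ^ 2) *
      (Real.exp (2 * g x / h) * realSchrodinger h Q u x ^ 2
        - (partialDeriv 0 (carlemanFlux h l p g Q (expConj h g u) 0) x
          + partialDeriv 1 (carlemanFlux h l p g Q (expConj h g u) 1) x)) := by
  have hS := hP.S_nonneg
  have hl := hP.l_pos
  have hh := hP.h_pos
  have hcv : ContDiff ℝ ∞ (expConj h g u) := hg ▸ contDiff_expConj hu
  have hpt := carleman_pointwise_conj hP hQ hcv hg
    (fun h' => hx (tsupport_expConj_subset g h'))
  have hexp : Real.exp (2 * g x / h) = Real.exp (g x / h) ^ 2 := by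
    rw [← Real.exp_nat_mul]; congr 1; push_cast; ring
  rw [conjSymm_add_conjAnti_expConj hh.ne' hu x hg, mul_pow, ← hexp] at hpt
  refine le_trans ?_ (mul_le_mul_of_nonneg_left hpt (by positivity))
  by_cases hxu : x ∈ tsupport u
  · obtain ⟨h1, h2, -⟩ := hx hxu
    have hgA : g x ^ 2 ≤ A ^ 2 := by
      have hm := hP.one_le_m
      have hs0 := sqDist_nonneg p x
      have hA : 0 ≤ A := by rw [hP.A_eq]; positivity
      rw [hg, gaussianWeight]
      refine pow_le_pow_left₀ (by positivity) ?_ 2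
      exact mul_le_of_le_one_right hA (Real.exp_le_one_iff.2 (by nlinarith))
    have hd (i : Fin 2) : Real.exp (g x / h) * (h * partialDeriv i u x) =
        h * partialDeriv i (expConj h g u) x
          + 2 * l * (x i - p i) * g x * expConj h g u x := by
      subst hg
      rw [partialDeriv_expConj (hu.differentiable (by simp))]
      simp only [expConj]
      field_simp
      ring
    have e0 : Real.exp (2 * g x / h) *
        (u x ^ 2 + h ^ 2 * (partialDeriv 0 u x ^ 2 + partialDeriv 1 u x ^ 2)) =
        expConj h g u x ^ 2 +
        ((h * partialDeriv 0 (expConj h g u) x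
          + 2 * l * (x 0 - p 0) * g x * expConj h g u x) ^ 2
        + (h * partialDeriv 1 (expConj h g u) x
          + 2 * l * (x 1 - p 1) * g x * expConj h g u x) ^ 2) := by
      rw [← hd, ← hd, hexp, expConj]; ring
    have e1 : 4 * l ^ 2 * sqDist p x * g x ^ 2 ≤ 4 * l ^ 2 * S * A ^ 2 := by gcongr
    rw [e0, mul_left_comm (1 + 8 * l ^ 2 * S * A ^ 2)]
    gcongr
    have e2 : 8 * l ^ 2 * sqDist p x * g x ^ 2 * expConj h g u x ^ 2 ≤
        8 * l ^ 2 * S * A ^ 2 * expConj h g u x ^ 2 := by gcongr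
    have e3 : 0 ≤ 8 * l ^ 2 * S * A ^ 2 * (4 * h ^ 2 *
      (partialDeriv 0 (expConj h g u) x ^ 2 + partialDeriv 1 (expConj h g u) x ^ 2)) := by
      positivity
    unfold sqDist at e2
    have f (i : Fin 2) := sq_nonneg (h * partialDeriv i (expConj h g u) x
      - 2 * l * (x i - p i) * g x * expConj h g u x)
    have g0 : 0 ≤ h ^ 2 * (partialDeriv 0 (expConj h g u) x ^ 2 +
      partialDeriv 1 (expConj h g u) x ^ 2) := by positivity
    linarith [f 0, f 1]
  · have d0 : u x = 0 := image_eq_zero_of_notMem_tsupport hxu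
    have d1 (i) : partialDeriv i u x = 0 := partialDeriv_eq_zero_of_notMem_tsupport hxu
    simp only [d0, d1]
    norm_num
    positivity

lemma contDiff_carlemanFlux {v : Plane → ℝ} (hQ : ContDiff ℝ 1 Q) (hv : ContDiff ℝ ∞ v)
    (i : Fin 2) : ContDiff ℝ 1 (carlemanFlux h l p (gaussianWeight A l p) Q v i) := by
  have h1 : ContDiff ℝ 1 (sqDist p) := (contDiff_sqDist p).of_le (by simp)
  have h2 : ContDiff ℝ 1 (gaussianWeight A l p) := (contDiff_gaussianWeight A l p).of_le (by simp)
  have h4 : ContDiff ℝ 1 v := hv.of_le (by simp)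
  have h5 : ∀ j, ContDiff ℝ 1 (partialDeriv j v) :=
    fun j => (contDiff_partialDeriv (i := j) hv).of_le (by simp)
  have h6 := h5 0
  have h7 := h5 1
  have h8 := h5 i
  unfold carlemanFlux
  fun_prop

lemma hasCompactSupport_carlemanFlux {g v : Plane → ℝ} (hv : HasCompactSupport v)
    (i : Fin 2) : HasCompactSupport (carlemanFlux h l p g Q v i) := by
  refine HasCompactSupport.intro hv fun x hx => ?_
  have d0 : v x = 0 := image_eq_zero_of_notMem_tsupport hx
  have d1 (i) : partialDeriv i v x = 0 := partialDeriv_eq_zero_of_notMem_tsupport hx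
  simp [carlemanFlux, d0, d1]

/-- The two densities of the Carleman estimate are integrable. -/
lemma integrable_exp_mul_energy (hu : ContDiff ℝ ∞ u) (hus : HasCompactSupport u)
    {w : Plane → ℝ} (hw : Continuous w) (c : ℝ) :
    Integrable fun x => Real.exp (w x) *
      (u x ^ 2 + c * (partialDeriv 0 u x ^ 2 + partialDeriv 1 u x ^ 2)) := by
  have h0 := (contDiff_partialDeriv (i := 0) hu).continuous
  have h1 := (contDiff_partialDeriv (i := 1) hu).continuous
  have h2 := hu.continuous
  refine Continuous.integrable_of_hasCompactSupport (by fun_prop)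
    (HasCompactSupport.intro hus fun x hx => ?_)
  simp [image_eq_zero_of_notMem_tsupport hx, partialDeriv_eq_zero_of_notMem_tsupport hx]

lemma integrable_exp_mul_sq_realSchrodinger (hu : ContDiff ℝ ∞ u) (hus : HasCompactSupport u)
    {w : Plane → ℝ} (hw : Continuous w) (hQ : Continuous Q) (h : ℝ) :
    Integrable fun x => Real.exp (w x) * realSchrodinger h Q u x ^ 2 := by
  have h0 := (contDiff_partialDeriv (i := 0) (contDiff_partialDeriv (i := 0) hu)).continuous
  have h1 := (contDiff_partialDeriv (i := 1) (contDiff_partialDeriv (i := 1) hu)).continuous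
  have h2 := hu.continuous
  have d2 {x : Plane} (hx : x ∉ tsupport u) (i) : partialDeriv i (partialDeriv i u) x = 0 :=
    partialDeriv_eq_zero_of_notMem_tsupport fun hh => hx (tsupport_partialDeriv_subset hh)
  refine Continuous.integrable_of_hasCompactSupport (by unfold realSchrodinger; fun_prop)
    (HasCompactSupport.intro hus fun x hx => ?_)
  simp [realSchrodinger, image_eq_zero_of_notMem_tsupport hx, d2 hx]

/-- Integration of the pointwise bound: the fluxes are C¹ with compact support, so their divergence
integrates to zero. -/
theorem carleman_real (hP : CarlemanParams l A K S m h)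
    (hQ : ContDiff ℝ 1 Q) (hu : ContDiff ℝ ∞ u) (hus : HasCompactSupport u)
    (hx : ∀ x ∈ tsupport u, CarlemanPoint l K S p Q x) :
    h * l * ∫ x, Real.exp (2 * gaussianWeight A l p x / h) *
        (u x ^ 2 + h ^ 2 * (partialDeriv 0 u x ^ 2 + partialDeriv 1 u x ^ 2)) ≤
      (1 + 8 * l ^ 2 * S * A ^ 2) *
      ∫ x, Real.exp (2 * gaussianWeight A l p x / h) * realSchrodinger h Q u x ^ 2 := by
  have hgc := (contDiff_gaussianWeight A l p).continuous
  have hw : Continuous fun x => 2 * gaussianWeight A l p x / h := by fun_prop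
  have hvc := contDiff_expConj (h := h) (l := l) (A := A) (p := p) hu
  have hvs : HasCompactSupport (expConj h (gaussianWeight A l p) u) :=
    hus.of_isClosed_subset (isClosed_tsupport _) (tsupport_expConj_subset _)
  have hF (i : Fin 2) := contDiff_carlemanFlux (h := h) (l := l) (A := A) (p := p) hQ hvc i
  have hFs (i : Fin 2) : HasCompactSupport (carlemanFlux h l p (gaussianWeight A l p) Q
    (expConj h (gaussianWeight A l p) u) i) := hasCompactSupport_carlemanFlux hvs i
  have hFi (i : Fin 2) := (continuous_partialDeriv (i := i) (hF i)).integrable_of_hasCompactSupport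
    (hasCompactSupport_partialDeriv (hFs i)) (μ := volume)
  have hI := integrable_exp_mul_sq_realSchrodinger hu hus hw hQ.continuous h
  have hmono := integral_mono
    ((integrable_exp_mul_energy hu hus hw (h ^ 2)).const_mul (h * l))
    ((hI.sub ((hFi 0).add (hFi 1))).const_mul (1 + 8 * l ^ 2 * S * A ^ 2))
    (fun x => carleman_pointwise hP hQ hu rfl (hx x))
  rw [integral_const_mul, integral_const_mul, integral_sub' hI ((hFi 0).add (hFi 1)),
    integral_add' (hFi 0) (hFi 1), integral_partialDeriv_eq_zero (hF 0) (hFs 0),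
    integral_partialDeriv_eq_zero (hF 1) (hFs 1), add_zero, sub_zero] at hmono
  exact hmono

end Estimate

/-! ### Bounds on the regularized potential -/

/-- The rescaled kernel `θ⁻² ρ(· / θ)`. -/
def rescaledKernel (ρ : Plane → ℝ) (θ : ℝ) (t : Plane) : ℝ := 1 / θ ^ 2 * ρ (θ⁻¹ • t)

section Kernel

variable {ρ W : Plane → ℝ} {θ M : ℝ}

lemma contDiff_rescaledKernel (hρ : IsRegularizingKernel ρ) :
    ContDiff ℝ ∞ (rescaledKernel ρ θ) := by
  have := hρ.contDiff
  unfold rescaledKernel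
  fun_prop

lemma hasCompactSupport_rescaledKernel (hρ : IsRegularizingKernel ρ) (hθ : 0 < θ) :
    HasCompactSupport (rescaledKernel ρ θ) :=
  (hρ.hasCompactSupport.comp_smul (inv_ne_zero hθ.ne')).mul_left

lemma partialDeriv_rescaledKernel (hρ : IsRegularizingKernel ρ) (i : Fin 2) :
    partialDeriv i (rescaledKernel ρ θ) =
      fun t => θ⁻¹ * (1 / θ ^ 2 * partialDeriv i ρ (θ⁻¹ • t)) := by
  ext t
  have h1 : HasFDerivAt ρ (fderiv ℝ ρ (θ⁻¹ • t)) (θ⁻¹ • t) :=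
    (hρ.contDiff.differentiable (by simp) _).hasFDerivAt
  have h2 : HasFDerivAt (fun t : Plane => θ⁻¹ • t) (θ⁻¹ • ContinuousLinearMap.id ℝ Plane) t :=
    (hasFDerivAt_id t).const_smul θ⁻¹
  have h3 := (h1.comp t h2).const_mul (1 / θ ^ 2)
  rw [partialDeriv, show rescaledKernel ρ θ = fun t => 1 / θ ^ 2 * (ρ ∘ fun t => θ⁻¹ • t) t from
    rfl, h3.fderiv]
  simp [partialDeriv]
  ring

lemma integral_rescale (f : Plane → ℝ) (hθ : 0 < θ) :
    ∫ t, 1 / θ ^ 2 * f (θ⁻¹ • t) = ∫ t, f t := by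
  rw [integral_const_mul, Measure.integral_comp_smul]
  simp only [finrank_euclideanSpace, Fintype.card_fin, smul_eq_mul]
  rw [abs_of_pos (by positivity)]
  field_simp

lemma regularized_eq_convolution :
    regularized ρ W θ = convolution (rescaledKernel ρ θ) W (ContinuousLinearMap.mul ℝ ℝ) := by
  ext x
  simp only [regularized, convolution, rescaledKernel, ContinuousLinearMap.mul_apply']
  congr 1
  ext t
  ring

lemma contDiff_regularized (hρ : IsRegularizingKernel ρ) (hθ : 0 < θ)
    (hW : LocallyIntegrable W) : ContDiff ℝ ∞ (regularized ρ W θ) := by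
  rw [regularized_eq_convolution]
  exact (hasCompactSupport_rescaledKernel hρ hθ).contDiff_convolution_left _
    (contDiff_rescaledKernel hρ) hW

lemma partialDeriv_regularized (hρ : IsRegularizingKernel ρ) (hθ : 0 < θ)
    (hW : LocallyIntegrable W) (i : Fin 2) (x : Plane) :
    partialDeriv i (regularized ρ W θ) x =
      ∫ t, partialDeriv i (rescaledKernel ρ θ) t * W (x - t) := by
  have hc := hasCompactSupport_rescaledKernel hρ hθ
  have hd : ContDiff ℝ 1 (rescaledKernel ρ θ) := (contDiff_rescaledKernel hρ).of_le (by simp)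
  have h := hc.hasFDerivAt_convolution_left (ContinuousLinearMap.mul ℝ ℝ) hd hW x
  have hex : ConvolutionExistsAt (fderiv ℝ (rescaledKernel ρ θ)) W x
      ((ContinuousLinearMap.mul ℝ ℝ).precompL Plane) volume :=
    (hc.fderiv ℝ).convolutionExists_left _ (hd.continuous_fderiv (by simp)) hW x
  rw [regularized_eq_convolution, partialDeriv, h.fderiv, convolution,
    ContinuousLinearMap.integral_apply hex]
  simp [partialDeriv, ContinuousLinearMap.precompL_apply]

lemma support_rescaledKernel_subset (hρ : IsRegularizingKernel ρ) (hθ : 0 < θ) :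
    tsupport (rescaledKernel ρ θ) ⊆ Metric.ball 0 θ := by
  have h : Function.support (rescaledKernel ρ θ) ⊆ (fun t => θ⁻¹ • t) ⁻¹' tsupport ρ := by
    intro t ht
    exact subset_tsupport _ fun h => ht (by simp [rescaledKernel, h])
  have hcl : IsClosed ((fun t : Plane => θ⁻¹ • t) ⁻¹' tsupport ρ) :=
    (isClosed_tsupport ρ).preimage (continuous_const_smul _)
  intro t ht
  have := hρ.tsupport_subset (closure_minimal h hcl ht)
  rw [mem_ball_zero_iff, norm_smul, norm_inv, Real.norm_of_nonneg hθ.le,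
    inv_mul_lt_iff₀ hθ, mul_one] at this
  simpa using this

lemma abs_regularized_le (hρ : IsRegularizingKernel ρ) (hθ : 0 < θ)
    (hM : ∀ x, |W x| ≤ M) (x : Plane) :
    |regularized ρ W θ x| ≤ M * ∫ t, |ρ t| := by
  have hint : Integrable fun t => M * |rescaledKernel ρ θ t| :=
    (((contDiff_rescaledKernel hρ).continuous.integrable_of_hasCompactSupport
      (hasCompactSupport_rescaledKernel hρ hθ)).abs).const_mul M
  calc |regularized ρ W θ x| ≤ ∫ t, M * |rescaledKernel ρ θ t| := by
        rw [← Real.norm_eq_abs, regularized]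
        refine norm_integral_le_of_norm_le hint (ae_of_all _ fun t => ?_)
        rw [Real.norm_eq_abs, mul_right_comm, mul_comm, abs_mul]
        exact mul_le_mul_of_nonneg_right (hM _) (abs_nonneg _)
    _ = M * ∫ t, |ρ t| := by
        rw [integral_const_mul, ← integral_rescale (fun t => |ρ t|) hθ]
        simp only [rescaledKernel, abs_mul, abs_of_pos (show 0 < 1 / θ ^ 2 by positivity)]

/-- The derivative of the kernel has integral zero, so the constant `W x` may be subtracted under
the integral; differentiating the rescaled kernel costs 1/θ in L¹. -/
lemma abs_partialDeriv_regularized_le (hρ : IsRegularizingKernel ρ) (hθ : 0 < θ)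
    (hW : LocallyIntegrable W) (i : Fin 2) {x : Plane} {osc : ℝ}
    (hosc : ∀ t ∈ Metric.ball (0 : Plane) θ, |W (x - t) - W x| ≤ osc) :
    |partialDeriv i (regularized ρ W θ) x| ≤ osc / θ * ∫ t, |partialDeriv i ρ t| := by
  have hc := hasCompactSupport_rescaledKernel hρ hθ
  have hd := contDiff_rescaledKernel (θ := θ) hρ
  have hd1 : ContDiff ℝ 1 (rescaledKernel ρ θ) := hd.of_le (by simp)
  have hkc := (contDiff_partialDeriv (i := i) hd).continuous
  have hks := hasCompactSupport_partialDeriv (i := i) hc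
  have hk : Integrable (partialDeriv i (rescaledKernel ρ θ)) :=
    hkc.integrable_of_hasCompactSupport hks
  have hex : Integrable fun t => partialDeriv i (rescaledKernel ρ θ) t * W (x - t) :=
    hks.convolutionExists_left (ContinuousLinearMap.mul ℝ ℝ) hkc hW x
  have hsub : partialDeriv i (regularized ρ W θ) x =
      ∫ t, partialDeriv i (rescaledKernel ρ θ) t * (W (x - t) - W x) := by
    simp only [mul_sub]
    rw [integral_sub hex (hk.mul_const _), integral_mul_const,
      integral_partialDeriv_eq_zero hd1 hc, zero_mul, sub_zero, partialDeriv_regularized hρ hθ hW]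
  rw [hsub]
  calc |∫ t, partialDeriv i (rescaledKernel ρ θ) t * (W (x - t) - W x)|
    _ ≤ ∫ t, osc * |partialDeriv i (rescaledKernel ρ θ) t| := by
        rw [← Real.norm_eq_abs]
        refine norm_integral_le_of_norm_le (hk.abs.const_mul osc) (ae_of_all _ fun t => ?_)
        rw [Real.norm_eq_abs, abs_mul, mul_comm]
        by_cases ht : t ∈ tsupport (rescaledKernel ρ θ)
        · exact mul_le_mul_of_nonneg_right (hosc t (support_rescaledKernel_subset hρ hθ ht))
            (abs_nonneg _)
        · simp [partialDeriv_eq_zero_of_notMem_tsupport ht]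
    _ = osc / θ * ∫ t, |partialDeriv i ρ t| := by
        rw [integral_const_mul, ← integral_rescale (fun t => |partialDeriv i ρ t|) hθ,
          partialDeriv_rescaledKernel hρ]
        simp only [abs_mul, abs_of_pos (show 0 < 1 / θ ^ 2 by positivity),
          abs_of_pos (inv_pos.2 hθ)]
        rw [integral_const_mul]
        ring

end Kernel

/-! ### The modulus and its linear lower bound -/

section Modulus

variable {R₀ R₁ M θ : ℝ} {V W : Plane → ℝ}

lemma exists_abs_zeroExtension_le (hV : ∃ M : ℝ, ∀ x ∈ Metric.ball (0 : Plane) R₁, |V x| ≤ M) :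
    ∃ M : ℝ, 0 ≤ M ∧ ∀ x, |zeroExtension R₁ V x| ≤ M := by
  obtain ⟨M, hM⟩ := hV
  refine ⟨max M 0, le_max_right _ _, fun x => ?_⟩
  by_cases hx : x ∈ Metric.ball (0 : Plane) R₁
  · rw [zeroExtension, Set.indicator_of_mem hx]
    exact (hM x hx).trans (le_max_left _ _)
  · rw [zeroExtension, Set.indicator_of_notMem hx, abs_zero]
    exact le_max_right _ _

lemma integrable_zeroExtension
    (hVmeas : AEMeasurable V (volume.restrict (Metric.ball (0 : Plane) R₁)))
    (hV : ∃ M : ℝ, ∀ x ∈ Metric.ball (0 : Plane) R₁, |V x| ≤ M) :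
    Integrable (zeroExtension R₁ V) := by
  obtain ⟨M, hM⟩ := hV
  rw [zeroExtension, integrable_indicator_iff Metric.isOpen_ball.measurableSet]
  exact IntegrableOn.of_bound measure_ball_lt_top hVmeas.aestronglyMeasurable M
    (ae_restrict_of_forall_mem Metric.isOpen_ball.measurableSet hM)

/-- Boundedness of `W` is essential: a real supremum over an unbounded family would default to 0. -/
lemma abs_sub_le_localOscillation (hW : ∀ x, |W x| ≤ M) {x t : Plane}
    (hx : x ∈ Metric.ball (0 : Plane) R₀) (ht : t ∈ Metric.ball (0 : Plane) θ) :
    |W (x - t) - W x| ≤ localOscillation R₀ W θ := by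
  have hM : 0 ≤ M := (abs_nonneg _).trans (hW 0)
  have hb (y s : Plane) : |W (y - s) - W y| ≤ M + M :=
    (abs_sub _ _).trans (add_le_add (hW _) (hW _))
  have h1 : |W (x - t) - W x| ≤ ⨆ t : Metric.ball (0 : Plane) θ, |W (x - t.1) - W x| :=
    le_ciSup (f := fun t : Metric.ball (0 : Plane) θ => |W (x - t.1) - W x|)
      ⟨M + M, by rintro _ ⟨s, rfl⟩; exact hb _ _⟩ ⟨t, ht⟩
  refine h1.trans (le_ciSup (f := fun x : Metric.ball (0 : Plane) R₀ =>
    ⨆ t : Metric.ball (0 : Plane) θ, |W (x.1 - t.1) - W x.1|) ⟨M + M, ?_⟩ ⟨x, hx⟩)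
  rintro _ ⟨y, rfl⟩
  exact Real.iSup_le (fun s => hb _ _) (by positivity)

lemma localOscillation_le_omegaV : localOscillation R₀ W θ ≤ omegaV R₀ W θ := by
  unfold omegaV
  split_ifs
  · exact le_max_right _ _
  · exact le_rfl

/-- Chaining along the segment from 0 to `y`: each step is shorter than θ and starts inside the
ball, so it changes `W` by at most the oscillation. -/
lemma abs_sub_le_mul_localOscillation (hW : ∀ x, |W x| ≤ M) {y : Plane}
    (hy : y ∈ Metric.ball (0 : Plane) R₀) {N : ℕ} (hN : 0 < N) (hyN : ‖y‖ < N * θ) (k : ℕ)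
    (hk : k ≤ N) : |W (((k : ℝ) / N) • y) - W 0| ≤ k * localOscillation R₀ W θ := by
  have hN' : (0 : ℝ) < N := by exact_mod_cast hN
  induction k with
  | zero => simp
  | succ k ih =>
    have hxk : ((k : ℝ) / N) • y ∈ Metric.ball (0 : Plane) R₀ := by
      rw [mem_ball_zero_iff] at hy ⊢
      rw [norm_smul, Real.norm_of_nonneg (by positivity)]
      have : (k : ℝ) / N ≤ 1 := by
        rw [div_le_one hN']
        exact_mod_cast (Nat.le_succ k).trans hk
      exact (mul_le_of_le_one_left (norm_nonneg _) this).trans_lt hy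
    have ht : -((1 / (N : ℝ)) • y) ∈ Metric.ball (0 : Plane) θ := by
      rw [mem_ball_zero_iff, norm_neg, norm_smul, Real.norm_of_nonneg (by positivity),
        one_div, inv_mul_lt_iff₀ hN']
      exact hyN
    have hstep := abs_sub_le_localOscillation hW hxk ht
    rw [show ((k : ℝ) / N) • y - -((1 / (N : ℝ)) • y) = (((k + 1 : ℕ) : ℝ) / N) • y by
      rw [sub_neg_eq_add, ← add_smul]; congr 1; push_cast; ring] at hstep
    have := abs_sub_le (W ((((k + 1 : ℕ) : ℝ) / N) • y)) (W (((k : ℝ) / N) • y)) (W 0)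
    have := ih ((Nat.le_succ k).trans hk)
    push_cast at *
    linarith

/-- If W(y) ≠ W(0), a chain of N = ⌈R₀/θ⌉ steps forces osc(θ) ≥ |W(y) - W(0)|/N, and Nθ ≤ R₀ + 1. In
the constant case the maximum with θ gives c = 1. -/
lemma exists_mul_le_omegaV (hR₀ : 0 < R₀) (hW : ∀ x, |W x| ≤ M) :
    ∃ c : ℝ, 0 < c ∧ ∀ θ ∈ Set.Ioc (0 : ℝ) 1, c * θ ≤ omegaV R₀ W θ := by
  by_cases hc : ∃ c : ℝ, ∀ x ∈ Metric.ball (0 : Plane) R₀, W x = c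
  · refine ⟨1, one_pos, fun θ _ => ?_⟩
    rw [omegaV, if_pos hc, one_mul]
    exact le_max_left _ _
  · obtain ⟨y, hy, hne⟩ : ∃ y ∈ Metric.ball (0 : Plane) R₀, W y ≠ W 0 := by
      by_contra! h
      exact hc ⟨W 0, h⟩
    have hδ : 0 < |W y - W 0| := abs_pos.2 (sub_ne_zero.2 hne)
    refine ⟨|W y - W 0| / (R₀ + 1), by positivity, fun θ ⟨hθ, hθ1⟩ => ?_⟩
    rw [omegaV, if_neg hc]
    have hN : 0 < ⌈R₀ / θ⌉₊ := Nat.ceil_pos.2 (by positivity)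
    have hN' : (0 : ℝ) < ⌈R₀ / θ⌉₊ := by exact_mod_cast hN
    have hyN : ‖y‖ < ⌈R₀ / θ⌉₊ * θ :=
      (mem_ball_zero_iff.1 hy).trans_le ((div_le_iff₀ hθ).1 (Nat.le_ceil _))
    have h1 := abs_sub_le_mul_localOscillation hW hy hN hyN _ le_rfl
    rw [div_self hN'.ne', one_smul] at h1
    have hosc : 0 < localOscillation R₀ W θ := by
      by_contra! h
      nlinarith
    have h2 : (⌈R₀ / θ⌉₊ : ℝ) * θ ≤ R₀ + 1 := by
      have := (Nat.ceil_lt_add_one (a := R₀ / θ) (by positivity)).le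
      calc (⌈R₀ / θ⌉₊ : ℝ) * θ ≤ (R₀ / θ + 1) * θ := by gcongr
        _ = R₀ + θ := by field_simp
        _ ≤ R₀ + 1 := by linarith
    rw [div_mul_eq_mul_div, div_le_iff₀ (by linarith)]
    calc |W y - W 0| * θ ≤ ⌈R₀ / θ⌉₊ * localOscillation R₀ W θ * θ := by gcongr
      _ = localOscillation R₀ W θ * (⌈R₀ / θ⌉₊ * θ) := by ring
      _ ≤ localOscillation R₀ W θ * (R₀ + 1) := by gcongr

end Modulus

/-! ### Splitting into real and imaginary parts -/

section ComplexValued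

variable {u : Plane → ℂ}

lemma laplacian_eq_partialDeriv {f : Plane → ℝ} (hf : ContDiff ℝ ∞ f) (x : Plane) :
    (Δ f) x = partialDeriv 0 (partialDeriv 0 f) x + partialDeriv 1 (partialDeriv 1 f) x := by
  have hd : DifferentiableAt ℝ (fderiv ℝ f) x :=
    ((hf.fderiv_right (m := ∞) (by simp)).differentiable (by simp)) x
  have key (k : Fin 2) : partialDeriv k (partialDeriv k f) x =
      fderiv ℝ (fderiv ℝ f) x (EuclideanSpace.single k 1) (EuclideanSpace.single k 1) := by
    change fderiv ℝ (fun y => fderiv ℝ f y (EuclideanSpace.single k (1 : ℝ))) x _ = _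
    rw [fderiv_clm_apply hd (differentiableAt_const _)]
    simp
  rw [InnerProductSpace.laplacian_eq_iteratedFDeriv_orthonormalBasis f
    (EuclideanSpace.basisFun (Fin 2) ℝ)]
  simp [iteratedFDeriv_two_apply, key]

lemma contDiff_re (hu : ContDiff ℝ ∞ u) : ContDiff ℝ ∞ fun x => (u x).re :=
  Complex.reCLM.contDiff.comp hu

lemma contDiff_im (hu : ContDiff ℝ ∞ u) : ContDiff ℝ ∞ fun x => (u x).im :=
  Complex.imCLM.contDiff.comp hu

lemma gradNormSq_eq (hu : ContDiff ℝ ∞ u) (x : Plane) :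
    gradNormSq u x =
      (partialDeriv 0 (fun x => (u x).re) x ^ 2 + partialDeriv 1 (fun x => (u x).re) x ^ 2) +
      (partialDeriv 0 (fun x => (u x).im) x ^ 2 + partialDeriv 1 (fun x => (u x).im) x ^ 2) := by
  have hd : HasFDerivAt u (fderiv ℝ u x) x := (hu.differentiable (by simp) x).hasFDerivAt
  have hre : fderiv ℝ (fun x => (u x).re) x = Complex.reCLM.comp (fderiv ℝ u x) :=
    (Complex.reCLM.hasFDerivAt.comp x hd).fderiv
  have him : fderiv ℝ (fun x => (u x).im) x = Complex.imCLM.comp (fderiv ℝ u x) :=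
    (Complex.imCLM.hasFDerivAt.comp x hd).fderiv
  simp only [gradNormSq, partialDeriv, hre, him, Fin.sum_univ_two, Complex.sq_norm,
    Complex.normSq_apply, ContinuousLinearMap.comp_apply, Complex.reCLM_apply,
    Complex.imCLM_apply]
  ring

/-- The coefficients are real, so the operator acts on real and imaginary parts separately. -/
lemma norm_sq_schrodinger (hu : ContDiff ℝ ∞ u) {h E κ : ℝ} (W : Plane → ℝ) (x : Plane) :
    (realSchrodinger (h * κ) (fun y => κ ^ 2 * (W y - E)) (fun y => (u y).re) x) ^ 2 +
      (realSchrodinger (h * κ) (fun y => κ ^ 2 * (W y - E)) (fun y => (u y).im) x) ^ 2 =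
      κ ^ 4 * ‖schrodinger h W E u x‖ ^ 2 := by
  have h2 : ContDiffAt ℝ 2 u x := hu.contDiffAt.of_le
    (by simpa using (WithTop.coe_le_coe.2 le_top : ((2 : ℕ∞) : WithTop ℕ∞) ≤ ∞))
  have hre : ((Δ u) x).re = (Δ fun y => (u y).re) x :=
    (h2.laplacian_CLM_comp_left (l := Complex.reCLM)).symm
  have him : ((Δ u) x).im = (Δ fun y => (u y).im) x :=
    (h2.laplacian_CLM_comp_left (l := Complex.imCLM)).symm
  rw [laplacian_eq_partialDeriv (contDiff_re hu)] at hre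
  rw [laplacian_eq_partialDeriv (contDiff_im hu)] at him
  rw [Complex.sq_norm, Complex.normSq_apply]
  simp only [schrodinger, realSchrodinger, ← Complex.ofReal_pow, Complex.add_re, Complex.add_im,
    Complex.neg_re, Complex.neg_im, Complex.re_ofReal_mul, Complex.im_ofReal_mul, hre, him]
  ring

lemma tsupport_comp_subset_of_zero {f : ℂ → ℝ} (hf : f 0 = 0) :
    tsupport (fun x => f (u x)) ⊆ tsupport u :=
  closure_mono fun x hx hux => hx (by simp [hux, hf])

end ComplexValued

/-! ### Rescaling and uniformity in θ -/

/-- The rescaled Carleman estimate for complex-valued functions. -/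
lemma carleman_complex {l A K S m h κ E : ℝ} {p : Plane} {W : Plane → ℝ} {u : Plane → ℂ}
    (hP : CarlemanParams l A K S m (h * κ)) (hW : ContDiff ℝ 1 W)
    (hu : ContDiff ℝ ∞ u) (hus : HasCompactSupport u)
    (hx : ∀ x ∈ tsupport u, CarlemanPoint l K S p (fun y => κ ^ 2 * (W y - E)) x) :
    h * κ * l * ∫ x, Real.exp (2 * gaussianWeight A l p x / (h * κ)) *
        (‖u x‖ ^ 2 + κ ^ 2 * (h ^ 2 * gradNormSq u x)) ≤
      (1 + 8 * l ^ 2 * S * A ^ 2) * (κ ^ 4 *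
      ∫ x, Real.exp (2 * gaussianWeight A l p x / (h * κ)) * ‖schrodinger h W E u x‖ ^ 2) := by
  have hgc := (contDiff_gaussianWeight A l p).continuous
  have hw : Continuous fun x => 2 * gaussianWeight A l p x / (h * κ) := by fun_prop
  have hQ : ContDiff ℝ 1 fun y => κ ^ 2 * (W y - E) := by fun_prop
  have hre := tsupport_comp_subset_of_zero (u := u) (f := Complex.re) rfl
  have him := tsupport_comp_subset_of_zero (u := u) (f := Complex.im) rfl
  have hres : HasCompactSupport fun x => (u x).re :=
    hus.of_isClosed_subset (isClosed_tsupport _) hre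
  have hims : HasCompactSupport fun x => (u x).im :=
    hus.of_isClosed_subset (isClosed_tsupport _) him
  have h1 := carleman_real hP hQ (contDiff_re hu) hres fun x h' => hx x (hre h')
  have h2 := carleman_real hP hQ (contDiff_im hu) hims fun x h' => hx x (him h')
  have h3 := add_le_add h1 h2
  rw [← mul_add, ← mul_add, ← integral_add (integrable_exp_mul_energy (contDiff_re hu) hres hw _)
      (integrable_exp_mul_energy (contDiff_im hu) hims hw _),
    ← integral_add
      (integrable_exp_mul_sq_realSchrodinger (contDiff_re hu) hres hw hQ.continuous _)
      (integrable_exp_mul_sq_realSchrodinger (contDiff_im hu) hims hw hQ.continuous _)] at h3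
  rw [← integral_const_mul (κ ^ 4)]
  refine (le_of_eq ?_).trans (h3.trans (le_of_eq ?_))
  · refine congrArg _ (integral_congr_ae (ae_of_all _ fun x => ?_))
    dsimp only
    rw [gradNormSq_eq hu, Complex.sq_norm, Complex.normSq_apply]
    ring
  · refine congrArg _ (integral_congr_ae (ae_of_all _ fun x => ?_))
    dsimp only
    rw [← mul_add, norm_sq_schrodinger hu]
    ring

/-- The Carleman estimate on a region `T` where the Gaussian weight is non-degenerate. -/
theorem carleman_regularized {R₀ R₁ l S : ℝ} (hR₀ : 0 < R₀) (hl : 0 < l) (hS : 0 ≤ S)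
    (p : Plane) {T : Set Plane}
    (hT : ∀ x ∈ T, x ∈ Metric.ball (0 : Plane) R₀ ∧ 5 / 2 ≤ l * sqDist p x ∧ sqDist p x ≤ S)
    {V : Plane → ℝ} (hVmeas : AEMeasurable V (volume.restrict (Metric.ball (0 : Plane) R₁)))
    (hVbdd : ∃ M : ℝ, ∀ x ∈ Metric.ball (0 : Plane) R₁, |V x| ≤ M)
    {ρ : Plane → ℝ} (hρ : IsRegularizingKernel ρ) {I : Set ℝ} (hI : IsCompact I) :
    ∃ A : ℝ, 0 < A ∧ ∃ h₀ C : ℝ, 0 < h₀ ∧ 0 < C ∧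
      ∀ E ∈ I, ∀ h ∈ Set.Ioc (0 : ℝ) h₀, ∀ θ ∈ Set.Ioc (0 : ℝ) 1, ∀ u : Plane → ℂ,
        IsTestFunction T u →
        CarlemanInequality R₀ (regularized ρ (zeroExtension R₁ V) θ) E (gaussianWeight A l p)
          (omegaV R₀ (zeroExtension R₁ V) θ) C h θ u := by
  obtain ⟨M, hM0, hM⟩ := exists_abs_zeroExtension_le hVbdd
  have hloc : LocallyIntegrable (zeroExtension R₁ V) :=
    (integrable_zeroExtension hVmeas hVbdd).locallyIntegrable
  generalize zeroExtension R₁ V = W at *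
  obtain ⟨c, hc, hcω⟩ := exists_mul_le_omegaV hR₀ hM
  obtain ⟨B, hB⟩ := hI.isBounded.exists_norm_le
  have hN : 0 ≤ ∫ t, |ρ t| := integral_nonneg fun t => abs_nonneg _
  have hD (i : Fin 2) : 0 ≤ ∫ t, |partialDeriv i ρ t| := integral_nonneg fun t => abs_nonneg _
  -- A common bound for κ²(Ṽ_θ - E), using κ² ≤ 1/c, and for its partial derivatives, where κ²
  -- cancels ω/θ.
  set K : ℝ := (M * (∫ t, |ρ t|) + |B|) / c
    + ((∫ t, |partialDeriv 0 ρ t|) + ∫ t, |partialDeriv 1 ρ t|) with hK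
  have hD' (i : Fin 2) : ∫ t, |partialDeriv i ρ t| ≤ K := by
    have : 0 ≤ (M * (∫ t, |ρ t|) + |B|) / c := by positivity
    have := hD 0
    have := hD 1
    fin_cases i
    · change ∫ t, |partialDeriv 0 ρ t| ≤ K
      linarith
    · change ∫ t, |partialDeriv 1 ρ t| ≤ K
      linarith
  have hK1 : (M * (∫ t, |ρ t|) + |B|) / c ≤ K := by linarith [hD 0, hD 1]
  have hK0 : 0 ≤ K := (hD 0).trans (hD' 0)
  set m : ℝ := 1 + (2 + 12 * K + 8 * K * (1 + S)) / (200 * l) with hm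
  have hm1 : 1 ≤ m := le_add_of_nonneg_right (by positivity)
  have hmK : 2 + 12 * K + 8 * K * (1 + S) ≤ 200 * l * m ^ 2 := by
    have h1 : 200 * l * m = 200 * l + (2 + 12 * K + 8 * K * (1 + S)) := by
      rw [hm]; field_simp
    have h2 : 200 * l * m ≤ 200 * l * m ^ 2 := by
      gcongr; exact le_self_pow₀ hm1 two_ne_zero
    linarith
  set A : ℝ := m * Real.exp (l * S) with hA
  have hA0 : 0 < A := by positivity
  set H : ℝ := 36 * l * A + 4 * l ^ 3 * S ^ 2 with hH
  have hH0 : 0 ≤ H := by positivity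
  -- Since κ ≤ 1/√c, this h₀ gives hκ(1 + H) ≤ 1, hence both hκ ≤ 1 and hκH ≤ 1.
  refine ⟨A, hA0, √c / (1 + H), (1 + 8 * l ^ 2 * S * A ^ 2) / l, by positivity, by positivity, ?_⟩
  rintro E hE h ⟨hh, hhc⟩ θ hθ u ⟨hu, hus, huT⟩
  have hω := hcω θ hθ
  have hosc : localOscillation R₀ W θ ≤ omegaV R₀ W θ := localOscillation_le_omegaV
  have hθ0 := hθ.1
  have hω0 : 0 < omegaV R₀ W θ := lt_of_lt_of_le (by positivity) hω
  unfold CarlemanInequality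
  generalize omegaV R₀ W θ = w at *
  -- Writing θ = a² and ω = b² makes κ = a/b and turns the half-integer powers into integer ones.
  obtain ⟨a, ha, rfl⟩ : ∃ a : ℝ, 0 < a ∧ θ = a ^ 2 :=
    ⟨√θ, Real.sqrt_pos.2 hθ0, (Real.sq_sqrt hθ0.le).symm⟩
  obtain ⟨b, hb, rfl⟩ : ∃ b : ℝ, 0 < b ∧ w = b ^ 2 :=
    ⟨√w, Real.sqrt_pos.2 hω0, (Real.sq_sqrt hω0.le).symm⟩
  have r1 {y : ℝ} (hy : 0 < y) : (y ^ 2) ^ (1 / 2 : ℝ) = y := by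
    rw [← Real.sqrt_eq_rpow, Real.sqrt_sq hy.le]
  have r3 {y : ℝ} (hy : 0 < y) : (y ^ 2) ^ (3 / 2 : ℝ) = y ^ 3 := by
    rw [← Real.rpow_natCast, ← Real.rpow_natCast, ← Real.rpow_mul hy.le]
    norm_num
  have hab : √c * (a / b) ≤ 1 := by
    rw [← mul_div_assoc, div_le_one hb]
    refine le_of_sq_le_sq ?_ hb.le
    rw [mul_pow, Real.sq_sqrt hc.le]
    exact hω
  have hab2 : (a / b) ^ 2 ≤ 1 / c := by
    rw [div_pow, div_le_div_iff₀ (by positivity) hc]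
    linarith
  have hsmall : h * (a / b) * (1 + H) ≤ 1 := by
    have h1 : h * (1 + H) ≤ √c := (le_div_iff₀ (by positivity)).1 hhc
    calc h * (a / b) * (1 + H) = h * (1 + H) * (a / b) := by ring
      _ ≤ √c * (a / b) := by gcongr
      _ ≤ 1 := hab
  have hpos : 0 < h * (a / b) := by positivity
  have hP : CarlemanParams l A K S m (h * (a / b)) :=
    ⟨hpos, by nlinarith, by nlinarith, hl, hS, hm1, hmK, rfl⟩
  have hWc := contDiff_regularized hρ hθ0 hloc
  have hpt : ∀ x ∈ tsupport u,
      CarlemanPoint l K S p (fun y => (a / b) ^ 2 * (regularized ρ W (a ^ 2) y - E)) x := by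
    intro x hx
    obtain ⟨hxR, hx1, hx2⟩ := hT x (huT hx)
    refine ⟨hx1, hx2, ?_, fun i => ?_⟩
    · refine le_trans ?_ hK1
      have e1 := abs_regularized_le hρ hθ0 hM x
      have e2 : |E| ≤ |B| := (hB E hE).trans (le_abs_self B)
      rw [abs_mul, abs_of_nonneg (by positivity : 0 ≤ (a / b) ^ 2), ← one_div_mul_eq_div c]
      exact mul_le_mul hab2 ((abs_sub _ _).trans (add_le_add e1 e2)) (abs_nonneg _)
        (by positivity)
    · refine le_trans ?_ (hD' i)
      have e1 := abs_partialDeriv_regularized_le hρ hθ0 hloc i (x := x) fun t ht =>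
        (abs_sub_le_localOscillation hM hxR ht).trans hosc
      have hd := hWc.differentiable (by simp)
      simp (disch := fun_prop) only [partialDeriv_mul, partialDeriv_sub, partialDeriv_const]
      rw [zero_mul, zero_add, sub_zero, abs_mul, abs_of_nonneg (by positivity : 0 ≤ (a / b) ^ 2)]
      calc _ ≤ (a / b) ^ 2 * (b ^ 2 / a ^ 2 * ∫ t, |partialDeriv i ρ t|) := by gcongr
        _ = _ := by field_simp
  have hmain := carleman_complex hP (hWc.of_le (by simp)) hu hus hpt
  have hball {f : Plane → ℝ} (hf : ∀ x, x ∉ tsupport u → f x = 0) :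
      ∫ x in Metric.ball (0 : Plane) R₀, f x = ∫ x, f x :=
    setIntegral_eq_integral_of_forall_compl_eq_zero fun x hx =>
      hf x fun h' => hx (hT x (huT h')).1
  have hu0 {x : Plane} (hx : x ∉ tsupport u) : u x = 0 := image_eq_zero_of_notMem_tsupport hx
  have hdu0 {x : Plane} (hx : x ∉ tsupport u) : gradNormSq u x = 0 := by
    have : fderiv ℝ u x = 0 := by
      by_contra h'
      exact hx (support_fderiv_subset ℝ h')
    simp [gradNormSq, this]
  have hlap0 {x : Plane} (hx : x ∉ tsupport u) : (Δ u) x = 0 := by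
    have : u =ᶠ[nhds x] fun _ => (0 : ℂ) := notMem_tsupport_iff_eventuallyEq.1 hx
    rw [(InnerProductSpace.laplacian_congr_nhds this).eq_of_nhds]
    simp
  rw [hball (fun x hx => by simp [hu0 hx, hdu0 hx]),
    hball (fun x hx => by simp [schrodinger, hu0 hx, hlap0 hx])]
  have hwt : carlemanWeight (gaussianWeight A l p) (b ^ 2) h (a ^ 2) =
      fun x => Real.exp (2 * gaussianWeight A l p x / (h * (a / b))) := by
    ext x
    rw [carlemanWeight, r1 ha, r1 hb]
    congr 1
    field_simp
  rw [hwt, r3 ha, r3 hb, ← div_pow, ← div_pow]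
  have hκ : 0 < a / b := div_pos ha hb
  rw [div_mul_eq_mul_div, div_mul_eq_mul_div, le_div_iff₀ hl]
  -- The estimate has κ on the left and κ⁴ on the right; cancelling κ leaves κ³.
  refine le_of_mul_le_mul_left ?_ hκ
  refine (le_of_eq ?_).trans (hmain.trans (le_of_eq ?_)) <;> ring

lemma radiallyDecreasing_gaussianWeight {A l : ℝ} (hA : 0 < A) (hl : 0 < l) :
    RadiallyDecreasing (gaussianWeight A l 0) := by
  refine ⟨fun r => A * Real.exp (-(l * r ^ 2)), fun r hr s hs hrs => ?_, fun x => ?_⟩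
  · have : r ^ 2 < s ^ 2 := pow_lt_pow_left₀ hrs hr two_ne_zero
    simp only
    gcongr
  · simp [gaussianWeight, sqDist, EuclideanSpace.norm_sq_eq]

lemma sqDist_eq (p x : Plane) : sqDist p x = ‖x - p‖ ^ 2 := by
  simp [sqDist, EuclideanSpace.norm_sq_eq]

end

theorem mainTheorem2
    (R R₀ R₁ : ℝ) (hR : 0 < R) (hRR₀ : R < R₀) (hR₀R₁ : R₀ ≤ R₁)
    (V : Plane → ℝ)
    (hVmeas : AEMeasurable V (volume.restrict (Metric.ball (0 : Plane) R₁)))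
    (hVbdd : ∃ M : ℝ, ∀ x ∈ Metric.ball (0 : Plane) R₁, |V x| ≤ M)
    (ρ : Plane → ℝ) (hρ : IsRegularizingKernel ρ)
    (I : Set ℝ) (hI : IsCompact I) :
    (∃ φ : Plane → ℝ, ContDiff ℝ ∞ φ ∧ (∀ x, 0 < φ x) ∧
      ∃ h₀ θ₀ C : ℝ, 0 < h₀ ∧ 0 < θ₀ ∧ θ₀ ≤ 1 ∧ 0 < C ∧
        ∀ E ∈ I, ∀ h ∈ Set.Ioc (0 : ℝ) h₀, ∀ θ ∈ Set.Ioc (0 : ℝ) θ₀, ∀ u : Plane → ℂ,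
          IsTestFunction (Metric.ball 0 R₀) u →
          CarlemanInequality R₀ (regularized ρ (zeroExtension R₁ V) θ) E φ
            (omegaV R₀ (zeroExtension R₁ V) θ) C h θ u) ∧
    (∃ φ : Plane → ℝ, ContDiff ℝ ∞ φ ∧ (∀ x, 0 < φ x) ∧ RadiallyDecreasing φ ∧
      ∃ h₀ θ₀ C : ℝ, 0 < h₀ ∧ 0 < θ₀ ∧ θ₀ ≤ 1 ∧ 0 < C ∧
        ∀ E ∈ I, ∀ h ∈ Set.Ioc (0 : ℝ) h₀, ∀ θ ∈ Set.Ioc (0 : ℝ) θ₀, ∀ u : Plane → ℂ,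
          IsTestFunction (Metric.ball 0 R₀ \ Metric.ball 0 (R / 2)) u →
          CarlemanInequality R₀ (regularized ρ (zeroExtension R₁ V) θ) E φ
            (omegaV R₀ (zeroExtension R₁ V) θ) C h θ u) := by
  have hR₀ : 0 < R₀ := hR.trans hRR₀
  constructor
  -- With |p| = 2R₀, points of the ball lie at distance between R₀ and 3R₀ from the pole, which
  -- dictates `l` and `S`.
  · set p : Plane := EuclideanSpace.single 0 (2 * R₀) with hp
    have hpn : ‖p‖ = 2 * R₀ := by simp [hp, abs_of_pos hR₀]
    obtain ⟨A, hA, h₀, C, hh₀, hC, H⟩ := carleman_regularized (l := 5 / 2 / R₀ ^ 2)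
      (S := (3 * R₀) ^ 2) (T := Metric.ball 0 R₀) hR₀ (by positivity) (by positivity) p
      (fun x hx => by
        have hx' := mem_ball_zero_iff.1 hx
        refine ⟨hx, ?_, ?_⟩
        · have : R₀ ≤ ‖x - p‖ := by
            have := norm_sub_norm_le p x
            rw [norm_sub_rev] at this
            linarith
          rw [sqDist_eq, div_mul_eq_mul_div, le_div_iff₀ (by positivity)]
          gcongr
        · rw [sqDist_eq]
          gcongr
          linarith [norm_sub_le x p]) hVmeas hVbdd hρ hI
    exact ⟨_, contDiff_gaussianWeight _ _ _, fun x => by unfold gaussianWeight; positivity,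
      h₀, 1, C, hh₀, one_pos, le_rfl, hC, H⟩
  -- The pole is the origin, so the weight is radial; |x| ≥ R/2 on the admissible region fixes `l`.
  · have hl : 0 < 5 / 2 / (R / 2) ^ 2 := by positivity
    obtain ⟨A, hA, h₀, C, hh₀, hC, H⟩ := carleman_regularized (l := 5 / 2 / (R / 2) ^ 2)
      (S := R₀ ^ 2) (T := Metric.ball 0 R₀ \ Metric.ball 0 (R / 2)) hR₀ hl
      (by positivity) 0
      (fun x hx => by
        have hx' := mem_ball_zero_iff.1 hx.1
        have hx2 : R / 2 ≤ ‖x‖ := not_lt.1 fun h => hx.2 (mem_ball_zero_iff.2 h)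
        refine ⟨hx.1, ?_, ?_⟩
        · rw [sqDist_eq, sub_zero, div_mul_eq_mul_div, le_div_iff₀ (by positivity)]
          gcongr
        · rw [sqDist_eq, sub_zero]
          gcongr) hVmeas hVbdd hρ hI
    exact ⟨_, contDiff_gaussianWeight _ _ _, fun x => by unfold gaussianWeight; positivity,
      radiallyDecreasing_gaussianWeight hA hl, h₀, 1, C, hh₀, one_pos, le_rfl, hC, H⟩
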